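/- Let $X$ be a set (of records) and $n\ge 0$; a dataset is an element of $X^n$, $d$ is the Hamming distance on $X^n$, and $D,D'$ are adjacent if $d(D,D')=1$. Let $K\ge 1$. A mechanism is a map $M$ from $X^n$ to probability distributions on $[K]=\{1,\dots,K\}$; it is $(\varepsilon,\delta)$-DP if $\Pr[M(D)\in S]\le e^{\varepsilon}\Pr[M(D')\in S]+\delta$ for all adjacent $D,D'$ and all $S\subseteq[K]$, and $\varepsilon$-DP if it is $(\varepsilon,0)$-DP. A function $f:X^n\to\mathbb R$ has sensitivity at most $s$ if $|f(D)-f(D')|\le s$ for all adjacent $D,D'$. Its local sensitivity at $D$ is $LS_f(D)=\sup_{D':\,d(D,D')=1}|f(D)-f(D')|$, and its $\eta$-smoothed sensitivity at $D$ is $S_{f,\eta}(D)=\sup_{D'\in X^n}LS_f(D')\,e^{-\eta\, d(D,D')}$. Then there is an absolute constant $C>0$ such that the following holds for all $X$, $n$, $K$ and all score functions $q_1,\dots,q_K:X^n\to\mathbb R$. Write $q^\star(D)=\max_i q_i(D)$, and let $i^\star=i^\star(D)$ denote any index with $q_{i^\star}(D)=q^\star(D)$. Let $\varepsilon>0$ and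 $\beta\in(0,1)$. 1. (Exponential mechanism) If $s\ge 0$ and each $q_i$ has sensitivity at most $s$, then there is an $\varepsilon$-DP mechanism that, on every dataset $D$, outputs, except with probability at most $\beta$, an $i$ with $q_i(D)\ge q^\star(D)-C\,\frac{s\log(K/\beta)}{\varepsilon}$. 2. (Generalized exponential mechanism) If $\delta\ge 0$, $s_i\ge 0$ and $q_i$ has sensitivity at most $s_i$ for each $i$, then there is an $(\varepsilon,\delta)$-DP mechanism that, on every dataset $D$, outputs, except with probability at most $\beta$, an $i$ with $q_i(D)\ge q^\star(D)-C\,\frac{s_{i^\star}\log(K/\beta)}{\varepsilon}$. 3. (Margin-based mechanism) If $\varepsilon<1$, $0<\delta<1/4$, $s>0$ and each $q_i$ has sensitivity at most $s$, then there is an $(\varepsilon,\delta)$-DP mechanism that, on every dataset $D$ with $q^\star(D)\ge q_i(D)+C\,\frac{s\log(1/(\beta\delta))}{\varepsilon}$ for all $i\ne i^\star$, outputs $i^\star$ except with probability at most $\beta$. 4. (Generalized smooth sensitivity exponential mechanism) If $0<\delta\le\beta/K$, $\eta=\varepsilon/(4\ln(2/\delta))$, and $s_i:X^n\to[0,\infty)$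 are functions with $S_{q_i,\eta}(D)\le s_i(D)$ for all $i$ and $D$, then there is an $(\varepsilon,\delta)$-DP mechanism that, on every dataset $D$, outputs, except with probability at most $\beta$, an $i$ with $q_i(D)\ge q^\star(D)-C\,\frac{s_{i^\star}(D)\log(K/\beta)}{\varepsilon}$. -/

import Mathlib

open scoped ENNReal

namespace PrivSel

/-- A dataset: one record from the data universe `X` for each of `n` persons. -/
abbrev Dataset (X : Type*) (n : ℕ) : Type _ := Fin n → X

open Classical in
/-- Hamming distance: the number of persons whose records differ. -/
noncomputable def dataDist {X : Type*} {n : ℕ} (D D' : Dataset X n) : ℕ :=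
  hammingDist D D'

/-- Two datasets are adjacent if they differ in exactly one person's record. -/
def Adjacent {X : Type*} {n : ℕ} (D D' : Dataset X n) : Prop :=
  dataDist D D' = 1

/-- A randomized selection mechanism: it maps a dataset to a distribution over `K` candidates. -/
abbrev Mechanism (X : Type*) (n K : ℕ) : Type _ := Dataset X n → PMF (Fin K)

/-- The probability that the mechanism, run on `D`, outputs a candidate in `S`. -/
noncomputable def Mechanism.prob {X : Type*} {n K : ℕ} (M : Mechanism X n K)
    (D : Dataset X n) (S : Set (Fin K)) : ℝ≥0∞ :=
  (M D).toMeasure S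

/-- `(ε, δ)`-differential privacy; `ε`-differential privacy is the case `δ = 0`. -/
def IsDP {X : Type*} {n K : ℕ} (ε δ : ℝ) (M : Mechanism X n K) : Prop :=
  ∀ D D' : Dataset X n, Adjacent D D' → ∀ S : Set (Fin K),
    M.prob D S ≤ ENNReal.ofReal (Real.exp ε) * M.prob D' S + ENNReal.ofReal δ

/-- The score function `f` has (global) sensitivity at most `s`. -/
def SensitivityAtMost {X : Type*} {n : ℕ} (f : Dataset X n → ℝ) (s : ℝ) : Prop :=
  ∀ D D' : Dataset X n, Adjacent D D' → |f D - f D'| ≤ s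

/-- Local sensitivity of `f` at `D`: the largest change of `f` over the datasets adjacent to `D`
(possibly infinite). -/
noncomputable def localSensitivity {X : Type*} {n : ℕ} (f : Dataset X n → ℝ)
    (D : Dataset X n) : ℝ≥0∞ :=
  ⨆ (D' : Dataset X n) (_ : Adjacent D D'), ENNReal.ofReal |f D - f D'|

/-- The `η`-smoothed sensitivity of `f` at `D`: the supremum over all datasets `D'` of the local
sensitivity at `D'` discounted by `exp (-η * d(D, D'))`. -/
noncomputable def smoothSensitivity {X : Type*} {n : ℕ} (η : ℝ) (f : Dataset X n → ℝ)
    (D : Dataset X n) : ℝ≥0∞ :=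
  ⨆ D' : Dataset X n,
    localSensitivity f D' * ENNReal.ofReal (Real.exp (-(η * (dataDist D D' : ℝ))))

/-- Candidate `i` attains the maximum score on `D`. -/
def IsMaximizer {X : Type*} {n K : ℕ} (q : Fin K → Dataset X n → ℝ) (D : Dataset X n)
    (i : Fin K) : Prop :=
  ∀ j : Fin K, q j D ≤ q i D

end PrivSel

namespace PrivSel

open Finset

/-! ### Hamming adjacency and distributions with real point masses. -/

section Basic

variable {X : Type*} {n K : ℕ}

/-! The utility bounds come from integer statistics that move by at most one between adjacent
datasets. For parts 1, 2 and 4, the rank of a candidate counts how many of the tests `T 0`, ..., `T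
m` it fails. The tests compare scores corrected by multiples of the smooth bounds `S`, and weaken
with `k` just fast enough that passing test `k` on `D` implies passing test `k + 1` on any
neighbour. Some candidate passes all tests, so `exists_mechanism_of_rank` selects one passing `T m`
with probability at least `1 - β`, and `T m` is the error bound. This is
`exists_mechanism_of_smooth`, which is purely private; global sensitivity is the case `η = 0`. For
part 3, `exists_margin_mechanism` outputs the leader with odds growing geometrically in its
truncated integer margin, and a fixed default otherwise; only the jump from margin 0 to 1 costs `δ`.
-/

theorem Adjacent.symm {D D' : Dataset X n} (h : Adjacent D D') : Adjacent D' D := by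
  classical
  unfold Adjacent dataDist at *
  rwa [hammingDist_comm]

theorem dataDist_self (D : Dataset X n) : dataDist D D = 0 := by
  classical
  exact hammingDist_self D

theorem dataDist_triangle (D D' D'' : Dataset X n) :
    dataDist D D'' ≤ dataDist D D' + dataDist D' D'' := by
  classical
  exact hammingDist_triangle D D' D''

/-- The probability mass function on `Fin K` with given real point masses. -/
noncomputable def pmfOfReal (f : Fin K → ℝ) (h0 : ∀ i, 0 ≤ f i) (h1 : ∑ i, f i = 1) :
    PMF (Fin K) :=
  PMF.ofFintype (fun i => ENNReal.ofReal (f i)) (by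
    rw [← ENNReal.ofReal_sum_of_nonneg fun i _ => h0 i, h1, ENNReal.ofReal_one])

open Classical in
theorem pmfOfReal_toMeasure (f : Fin K → ℝ) (h0 : ∀ i, 0 ≤ f i) (h1 : ∑ i, f i = 1)
    (S : Set (Fin K)) :
    (pmfOfReal f h0 h1).toMeasure S = ENNReal.ofReal (∑ i with i ∈ S, f i) := by
  rw [PMF.toMeasure_apply_fintype, ENNReal.ofReal_sum_of_nonneg fun i _ => h0 i,
    Finset.sum_filter]
  exact Finset.sum_congr rfl fun i _ => by simp [Set.indicator_apply, pmfOfReal]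

theorem IsDP.mono {ε δ δ' : ℝ} {M : Mechanism X n K} (h : IsDP ε δ M) (hδ : δ ≤ δ') :
    IsDP ε δ' M := fun D D' hD S =>
  (h D D' hD S).trans (by gcongr)

open Classical in
theorem isDP_pmfOfReal {ε δ : ℝ} (hδ : 0 ≤ δ) (f : Dataset X n → Fin K → ℝ)
    (h0 : ∀ D i, 0 ≤ f D i) (h1 : ∀ D, ∑ i, f D i = 1)
    (h : ∀ D D', Adjacent D D' → ∀ S : Finset (Fin K),
      ∑ i ∈ S, f D i ≤ Real.exp ε * ∑ i ∈ S, f D' i + δ) :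
    IsDP ε δ (fun D => pmfOfReal (f D) (h0 D) (h1 D)) := by
  intro D D' hD S
  simp only [Mechanism.prob, pmfOfReal_toMeasure]
  rw [← ENNReal.ofReal_mul (Real.exp_pos ε).le, ← ENNReal.ofReal_add _ hδ]
  · exact ENNReal.ofReal_le_ofReal (h D D' hD _)
  · exact mul_nonneg (Real.exp_pos ε).le (Finset.sum_nonneg fun i _ => h0 D' i)

/-! ### Exponential mechanism on integer ranks. -/

/-- The exponential mechanism for an integer-valued penalty `r` of sensitivity one that vanishes
somewhere on every dataset: a penalty above `2 log (K / β) / ε` has probability at most `β`. -/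
theorem exists_mechanism_of_rank (hK : 0 < K) {ε β : ℝ} (hε : 0 < ε) (hβ : 0 < β)
    (r : Dataset X n → Fin K → ℕ)
    (hr : ∀ D D', Adjacent D D' → ∀ i, r D' i ≤ r D i + 1) (h0 : ∀ D, ∃ i, r D i = 0) :
    ∃ M : Mechanism X n K, IsDP ε 0 M ∧ ∀ D (S : Set (Fin K)),
      (∀ i ∈ S, Real.log (K / β) ≤ ε / 2 * r D i) → M.prob D S ≤ ENNReal.ofReal β := by
  classical
  set w : Dataset X n → Fin K → ℝ := fun D i => Real.exp (-(ε / 2 * r D i)) with hw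
  have hwpos : ∀ D i, 0 < w D i := fun D i => Real.exp_pos _
  have hW : ∀ D, 1 ≤ ∑ i, w D i := fun D => by
    obtain ⟨i, hi⟩ := h0 D
    have := Finset.single_le_sum (f := w D) (fun j _ => (hwpos D j).le) (mem_univ i)
    simpa [hw, hi] using this
  have hW0 : ∀ D, 0 < ∑ i, w D i := fun D => one_pos.trans_le (hW D)
  -- The half in the exponent pays once for the weight and once for the normalizer.
  have hwr : ∀ D D', Adjacent D D' → ∀ i, w D i ≤ Real.exp (ε / 2) * w D' i := by
    intro D D' hD i
    simp only [hw, ← Real.exp_add]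
    apply Real.exp_le_exp.2
    have : (r D' i : ℝ) ≤ r D i + 1 := by exact_mod_cast hr D D' hD i
    nlinarith
  have hp0 : ∀ D i, 0 ≤ w D i / ∑ j, w D j := fun D i => div_nonneg (hwpos D i).le (hW0 D).le
  have hp1 : ∀ D, ∑ i, w D i / ∑ j, w D j = 1 := fun D => by
    rw [← Finset.sum_div, div_self (hW0 D).ne']
  refine ⟨fun D => pmfOfReal (fun i => w D i / ∑ j, w D j) (hp0 D) (hp1 D),
    isDP_pmfOfReal le_rfl _ hp0 hp1 ?_, ?_⟩
  · intro D D' hD S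
    rw [add_zero, Finset.mul_sum]
    refine Finset.sum_le_sum fun i _ => ?_
    have h1 : ∑ j, w D' j ≤ Real.exp (ε / 2) * ∑ j, w D j := by
      rw [Finset.mul_sum]
      exact Finset.sum_le_sum fun j _ => hwr D' D hD.symm j
    rw [← mul_div_assoc, div_le_div_iff₀ (hW0 D) (hW0 D')]
    calc w D i * ∑ j, w D' j
        ≤ (Real.exp (ε / 2) * w D' i) * (Real.exp (ε / 2) * ∑ j, w D j) :=
          mul_le_mul (hwr D D' hD i) h1 (hW0 D').le (mul_pos (Real.exp_pos _) (hwpos D' i)).le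
      _ = Real.exp ε * w D' i * ∑ j, w D j := by
          have : Real.exp ε = Real.exp (ε / 2) * Real.exp (ε / 2) := by
            rw [← Real.exp_add, add_halves]
          rw [this]; ring
  · intro D S hS
    simp only [Mechanism.prob, pmfOfReal_toMeasure]
    apply ENNReal.ofReal_le_ofReal
    have hKpos : (0 : ℝ) < K := by exact_mod_cast hK
    have hi : ∀ i ∈ univ.filter (· ∈ S), w D i / ∑ j, w D j ≤ β / K := by
      intro i hi
      refine (div_le_self (hwpos D i).le (hW D)).trans ?_
      have h2 : Real.exp (Real.log (K / β)) = K / β := Real.exp_log (by positivity)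
      calc w D i ≤ Real.exp (-Real.log (K / β)) :=
            Real.exp_le_exp.2 (neg_le_neg (hS i (by simpa using hi)))
        _ = β / K := by rw [Real.exp_neg, h2, inv_div]
    calc _ ≤ (univ.filter (· ∈ S)).card • (β / K) := Finset.sum_le_card_nsmul _ _ _ hi
      _ ≤ K * (β / K) := by
          rw [nsmul_eq_mul]
          gcongr
          simpa using Finset.card_le_univ (univ.filter (· ∈ S))
      _ = β := by field_simp

/-! ### Selection with smooth sensitivity bounds. -/

/-- Selection with error proportional to `η`-smooth sensitivity bounds. -/
theorem exists_mechanism_of_smooth (hK : 0 < K) (q S : Fin K → Dataset X n → ℝ) {ε β η : ℝ}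
    (hε : 0 < ε) (hβ : 0 < β) (hβ1 : β < 1) (hη : 0 ≤ η)
    (hηL : η * (2 * Real.log (K / β) / ε) ≤ 1 / 2) (hS0 : ∀ i D, 0 ≤ S i D)
    (hq : ∀ i D D', Adjacent D D' → |q i D - q i D'| ≤ S i D)
    (hS : ∀ i D D', Adjacent D D' → S i D ≤ Real.exp η * S i D') :
    ∃ M : Mechanism X n K, IsDP ε 0 M ∧ ∀ D iStar,
      M.prob D {i | ¬ q iStar D - 10 * (S iStar D * Real.log (K / β) / ε) ≤ q i D}
        ≤ ENNReal.ofReal β := by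
  classical
  have hK1 : (1 : ℝ) ≤ K := by exact_mod_cast hK
  have hL : 0 < Real.log (K / β) := Real.log_pos (by rw [lt_div_iff₀ hβ]; linarith)
  set L := Real.log (K / β)
  set m : ℕ := ⌊2 * L / ε⌋₊
  have hm : (m : ℝ) ≤ 2 * L / ε := Nat.floor_le (by positivity)
  have hm' : 2 * L / ε < m + 1 := Nat.lt_floor_add_one _
  have hηm : η * m ≤ 1 / 2 := (mul_le_mul_of_nonneg_left hm hη).trans hηL
  -- `g` makes `α m = 0`, so the last test does not involve `S i D`. The sequences absorb, at each
  -- step, a score change of one unit of `S` and a factor `exp η` in `S`.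
  set g : ℝ := m * Real.exp (η * m) with hg
  set α : ℕ → ℝ := fun k => g * Real.exp (-(η * k)) - k with hα
  set γ : ℕ → ℝ := fun k => Real.exp (η * k) * (g + k) with hγ
  have hg0 : 0 ≤ g := by positivity
  have hαm : α m = 0 := by
    simp only [hα, hg, mul_assoc, ← Real.exp_add]
    simp
  have hαanti : Antitone α := by
    intro a b hab
    have : (a : ℝ) ≤ b := by exact_mod_cast hab
    simp only [hα]
    gcongr
  have hγmono : Monotone γ := by
    intro a b hab
    have : (a : ℝ) ≤ b := by exact_mod_cast hab
    simp only [hγ]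
    gcongr
  have hα0 : α 0 = g := by simp [hα]
  have hγ0 : γ 0 = g := by simp [hγ]
  have hexp : 1 ≤ Real.exp η := Real.one_le_exp hη
  have hαstep : ∀ k, 1 + α (k + 1) * Real.exp η ≤ α k := by
    intro k
    have : Real.exp (-(η * ((k + 1 : ℕ) : ℝ))) * Real.exp η = Real.exp (-(η * k)) := by
      rw [← Real.exp_add]; congr 1; push_cast; ring
    simp only [hα, sub_mul, mul_assoc, this]
    push_cast
    have : (0 : ℝ) ≤ k := k.cast_nonneg
    nlinarith
  have hγstep : ∀ k, Real.exp η * (γ k + 1) ≤ γ (k + 1) := by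
    intro k
    have h1 : Real.exp (η * ((k + 1 : ℕ) : ℝ)) = Real.exp η * Real.exp (η * k) := by
      rw [← Real.exp_add]; congr 1; push_cast; ring
    have h2 : 1 ≤ Real.exp (η * k) := Real.one_le_exp (by positivity)
    simp only [hγ, h1, mul_assoc]
    gcongr
    push_cast
    linarith
  set T : ℕ → Dataset X n → Fin K → Prop := fun k D i =>
    ∀ j, q j D - γ k * S j D ≤ q i D - α k * S i D with hT
  have hTmono : ∀ D i a b, a ≤ b → T a D i → T b D i := by
    intro D i a b hab h j
    have h1 := mul_le_mul_of_nonneg_right (hαanti hab) (hS0 i D)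
    have h2 := mul_le_mul_of_nonneg_right (hγmono hab) (hS0 j D)
    linarith [h j]
  have hTstep : ∀ D D' i k, Adjacent D D' → k + 1 ≤ m → T k D i → T (k + 1) D' i := by
    intro D D' i k hD hk h j
    have hα' : 0 ≤ α (k + 1) := hαm ▸ hαanti hk
    have hγ' : 0 ≤ γ k := by simp only [hγ]; positivity
    have h1 := abs_le.1 (hq i D D' hD)
    have h2 := abs_le.1 (hq j D D' hD)
    have h3 : α (k + 1) * S i D' ≤ (α k - 1) * S i D := by
      calc α (k + 1) * S i D' ≤ α (k + 1) * (Real.exp η * S i D) := by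
            gcongr; exact hS i D' D hD.symm
        _ = α (k + 1) * Real.exp η * S i D := by ring
        _ ≤ (α k - 1) * S i D :=
            mul_le_mul_of_nonneg_right (by linarith [hαstep k]) (hS0 i D)
    have h4 : (γ k + 1) * S j D ≤ γ (k + 1) * S j D' := by
      calc (γ k + 1) * S j D ≤ (γ k + 1) * (Real.exp η * S j D') := by
            gcongr; exact hS j D D' hD
        _ = Real.exp η * (γ k + 1) * S j D' := by ring
        _ ≤ γ (k + 1) * S j D' := mul_le_mul_of_nonneg_right (hγstep k) (hS0 j D')
    linarith [h j]
  obtain ⟨M, hM, hMβ⟩ := exists_mechanism_of_rank (X := X) (n := n) hK hε hβ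
    (fun D i => #{k ∈ range (m + 1) | ¬ T k D i}) (by
      intro D D' hD i
      calc #{k ∈ range (m + 1) | ¬ T k D' i}
          -- A test `k + 1` failed on `D'` forces test `k` to fail on `D`; only test 0 is unmatched.
          ≤ #(insert 0 ({k ∈ range (m + 1) | ¬ T k D i}.image (· + 1))) := by
            apply Finset.card_le_card
            intro k hk
            rw [mem_filter, mem_range] at hk
            rcases k with _ | k
            · exact mem_insert_self _ _
            · refine mem_insert_of_mem (mem_image_of_mem _ ?_)
              rw [mem_filter, mem_range]
              exact ⟨by omega, fun h => hk.2 (hTstep D D' i k hD (by omega) h)⟩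
        _ ≤ _ := (card_insert_le _ _).trans (Nat.add_le_add_right card_image_le _)) (by
      intro D
      have : Nonempty (Fin K) := ⟨⟨0, hK⟩⟩
      obtain ⟨i, hi⟩ := Finite.exists_max fun i => q i D - g * S i D
      refine ⟨i, ?_⟩
      rw [card_eq_zero, filter_eq_empty_iff]
      intro k _
      rw [not_not]
      refine hTmono D i 0 k k.zero_le fun j => ?_
      rw [hα0, hγ0]
      exact hi j)
  refine ⟨M, hM, fun D iStar => hMβ D _ fun i hi => ?_⟩
  have hnot : ¬ T m D i := by
    intro h
    apply hi
    have h1 := h iStar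
    rw [hαm, zero_mul, sub_zero] at h1
    -- The exponent is at most `1 / 2`, and `exp 1 < (7 / 4) ^ 2`. Then `7 / 4 * (11 / 4) ≤ 5`, and
    -- with `m ≤ 2 * L / ε` this gives the constant 10.
    have hE : Real.exp (η * m) ≤ 7 / 4 := by
      have h2 : Real.exp (η * m) * Real.exp (η * m) ≤ Real.exp 1 := by
        rw [← Real.exp_add]; exact Real.exp_le_exp.2 (by linarith)
      nlinarith [Real.exp_one_lt_d9, Real.exp_pos (η * m)]
    have hγm : γ m ≤ 10 * (L / ε) := by
      have hm0 : (0 : ℝ) ≤ m := m.cast_nonneg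
      have hE0 := Real.exp_pos (η * m)
      have h3 : γ m = m * (Real.exp (η * m) * (Real.exp (η * m) + 1)) := by
        simp only [hγ, hg]; ring
      have h4 : Real.exp (η * m) * (Real.exp (η * m) + 1) ≤ 5 := by nlinarith
      calc γ m ≤ m * 5 := by rw [h3]; gcongr
        _ ≤ 2 * L / ε * 5 := by gcongr
        _ = _ := by ring
    have h5 := mul_le_mul_of_nonneg_right hγm (hS0 iStar D)
    have h6 : 10 * (S iStar D * L / ε) = 10 * (L / ε) * S iStar D := by ring
    rw [h6]
    linarith
  -- Failing the weakest test means failing all `m + 1`, and `m + 1 > 2 * L / ε`.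
  have hcard : #{k ∈ range (m + 1) | ¬ T k D i} = m + 1 := by
    rw [filter_true_of_mem, card_range]
    intro k hk h
    exact hnot (hTmono D i k m (Nat.lt_succ_iff.1 (mem_range.1 hk)) h)
  simp only [hcard]
  push_cast
  rw [div_lt_iff₀ hε] at hm'
  linarith

theorem localSensitivity_le_smoothSensitivity (η : ℝ) (f : Dataset X n → ℝ) (D : Dataset X n) :
    localSensitivity f D ≤ smoothSensitivity η f D := by
  refine le_trans (le_of_eq ?_) (le_iSup _ D)
  simp [dataDist_self]

theorem smoothSensitivity_le_exp_mul {η : ℝ} (hη : 0 ≤ η) (f : Dataset X n → ℝ)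
    {D D' : Dataset X n} (h : Adjacent D D') :
    smoothSensitivity η f D ≤ ENNReal.ofReal (Real.exp η) * smoothSensitivity η f D' := by
  refine iSup_le fun E => ?_
  calc localSensitivity f E * ENNReal.ofReal (Real.exp (-(η * (dataDist D E : ℝ))))
      ≤ localSensitivity f E * (ENNReal.ofReal (Real.exp η) *
          ENNReal.ofReal (Real.exp (-(η * (dataDist D' E : ℝ))))) := by
        rw [← ENNReal.ofReal_mul (Real.exp_pos η).le, ← Real.exp_add]
        gcongr
        have h1 := dataDist_triangle D' D E
        rw [show dataDist D' D = 1 from h.symm] at h1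
        have h2 : (dataDist D' E : ℝ) ≤ 1 + dataDist D E := by exact_mod_cast h1
        nlinarith
    _ = ENNReal.ofReal (Real.exp η) * (localSensitivity f E *
          ENNReal.ofReal (Real.exp (-(η * (dataDist D' E : ℝ))))) := by ring
    _ ≤ _ := by
        gcongr
        exact le_iSup (fun E => localSensitivity f E *
          ENNReal.ofReal (Real.exp (-(η * (dataDist D' E : ℝ))))) E

/-! ### Margin-based mechanism. -/

/-- Output probability of the leading candidate, as a function of the integer margin `r`. -/
noncomputable def marginProb (ε δ : ℝ) (r : ℕ) : ℝ :=
  if r = 0 then 0 else δ * Real.exp (ε * (r - 1)) / (1 + δ * Real.exp (ε * (r - 1)))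

section MarginProb

variable {ε δ : ℝ}

theorem marginProb_zero : marginProb ε δ 0 = 0 := if_pos rfl

theorem marginProb_nonneg (hδ : 0 ≤ δ) (r : ℕ) : 0 ≤ marginProb ε δ r := by
  unfold marginProb
  split_ifs <;> positivity

theorem marginProb_le_one (hδ : 0 ≤ δ) (r : ℕ) : marginProb ε δ r ≤ 1 := by
  unfold marginProb
  split_ifs
  · exact zero_le_one
  · exact div_le_one_of_le₀ (by linarith) (by positivity)

theorem one_sub_marginProb (hδ : 0 ≤ δ) {r : ℕ} (hr : r ≠ 0) :
    1 - marginProb ε δ r = 1 / (1 + δ * Real.exp (ε * (r - 1))) := by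
  rw [marginProb, if_neg hr]
  have : 1 + δ * Real.exp (ε * (r - 1)) ≠ 0 := by positivity
  field_simp
  ring

theorem marginProb_one_le (hδ : 0 ≤ δ) : marginProb ε δ 1 ≤ δ := by
  rw [marginProb, if_neg one_ne_zero]
  simpa using div_le_self hδ (by linarith : 1 ≤ 1 + δ)

theorem exp_shift (ε : ℝ) (hε : 0 ≤ ε) (hδ : 0 ≤ δ) {r r' : ℕ} (h : r ≤ r' + 1) :
    δ * Real.exp (ε * (r - 1)) ≤ Real.exp ε * (δ * Real.exp (ε * (r' - 1))) := by
  have h1 : (r : ℝ) ≤ r' + 1 := by exact_mod_cast h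
  calc δ * Real.exp (ε * (r - 1)) ≤ δ * Real.exp (ε + ε * (r' - 1)) := by
        gcongr; nlinarith
    _ = _ := by rw [Real.exp_add]; ring

/-- For positive margins the odds change by a factor at most `exp ε`, so no additive loss occurs;
`δ` is spent only when `r' = 0` and `r = 1`. -/
theorem marginProb_le (hε : 0 ≤ ε) (hδ : 0 ≤ δ) {r r' : ℕ} (h : r ≤ r' + 1) :
    marginProb ε δ r ≤ Real.exp ε * marginProb ε δ r' + δ := by
  have he : 1 ≤ Real.exp ε := Real.one_le_exp hε
  have hnn := mul_nonneg (Real.exp_pos ε).le (marginProb_nonneg (ε := ε) hδ r')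
  rcases Nat.eq_zero_or_pos r with rfl | hr
  · rw [marginProb_zero]; positivity
  rcases Nat.eq_zero_or_pos r' with rfl | hr'
  · obtain rfl : r = 1 := by omega
    linarith [marginProb_one_le (ε := ε) hδ]
  suffices marginProb ε δ r ≤ Real.exp ε * marginProb ε δ r' by linarith
  have key := exp_shift ε hε hδ h
  rw [marginProb, marginProb, if_neg hr.ne', if_neg hr'.ne']
  have ha : 0 ≤ δ * Real.exp (ε * ((r : ℝ) - 1)) := by positivity
  have hb : 0 ≤ δ * Real.exp (ε * ((r' : ℝ) - 1)) := by positivity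
  generalize δ * Real.exp (ε * ((r : ℝ) - 1)) = a at *
  generalize δ * Real.exp (ε * ((r' : ℝ) - 1)) = b at *
  rw [← mul_div_assoc, div_le_div_iff₀ (by linarith) (by linarith)]
  nlinarith [mul_nonneg (mul_nonneg ha hb) (sub_nonneg.2 he)]

theorem one_sub_marginProb_le (hε : 0 ≤ ε) (hδ : 0 ≤ δ) {r r' : ℕ} (h : r' ≤ r + 1) :
    1 - marginProb ε δ r ≤ Real.exp ε * (1 - marginProb ε δ r') + δ := by
  have he : 1 ≤ Real.exp ε := Real.one_le_exp hε
  have hp := marginProb_nonneg (ε := ε) hδ r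
  have hp' := marginProb_le_one (ε := ε) hδ r'
  rcases Nat.eq_zero_or_pos r' with rfl | hr'
  · rw [marginProb_zero]; linarith
  rcases Nat.eq_zero_or_pos r with rfl | hr
  · obtain rfl : r' = 1 := by omega
    rw [marginProb_zero]
    nlinarith [marginProb_one_le (ε := ε) hδ]
  suffices 1 - marginProb ε δ r ≤ Real.exp ε * (1 - marginProb ε δ r') by linarith
  have key := exp_shift ε hε hδ h
  rw [one_sub_marginProb hδ hr.ne', one_sub_marginProb hδ hr'.ne']
  have ha : 0 ≤ δ * Real.exp (ε * ((r : ℝ) - 1)) := by positivity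
  have hb : 0 ≤ δ * Real.exp (ε * ((r' : ℝ) - 1)) := by positivity
  generalize δ * Real.exp (ε * ((r : ℝ) - 1)) = a at *
  generalize δ * Real.exp (ε * ((r' : ℝ) - 1)) = b at *
  rw [mul_one_div, div_le_div_iff₀ (by linarith) (by linarith)]
  linarith

end MarginProb

/-- Point masses of the distribution `p • δ_i + (1 - p) • δ_d`. -/
noncomputable def mixMass (d : Fin K) (p : ℝ) (i j : Fin K) : ℝ :=
  (if j = i then p else 0) + (if j = d then 1 - p else 0)

theorem sum_mixMass (d : Fin K) (p : ℝ) (i : Fin K) (S : Finset (Fin K)) :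
    ∑ j ∈ S, mixMass d p i j = (if i ∈ S then p else 0) + (if d ∈ S then 1 - p else 0) := by
  simp [mixMass, Finset.sum_add_distrib]

-- A lead above `2 * s` survives as a strict lead on every neighbour. Hence adjacent datasets mix
-- the default with one common candidate `i`, and privacy reduces to comparing two Bernoulli
-- parameters.
open Classical in
theorem exists_margin_mechanism (hK : 0 < K) (q : Fin K → Dataset X n → ℝ) {s ε δ β : ℝ}
    (hs : 0 < s) (hε : 0 < ε) (hδ : 0 < δ) (hβ : 0 < β) (m : ℕ)
    (hm : Real.log (1 / (β * δ)) ≤ ε * (m - 1)) (hm0 : m ≠ 0)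
    (hq : ∀ i, SensitivityAtMost (q i) s) :
    ∃ M : Mechanism X n K, IsDP ε δ M ∧ ∀ D iStar,
      (∀ i, i ≠ iStar → q i D + 2 * s * m < q iStar D) →
      M.prob D {i | i ≠ iStar} ≤ ENNReal.ofReal β := by
  set d : Fin K := ⟨0, hK⟩
  set U : ℕ → Dataset X n → Fin K → Prop := fun k D i =>
    ∀ j, j ≠ i → q j D + 2 * s * (k + 1) < q i D with hU
  set r : Dataset X n → Fin K → ℕ := fun D i => #{k ∈ range m | U k D i} with hr
  have hstep : ∀ D D' i k, Adjacent D D' → U (k + 1) D i → U k D' i := by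
    intro D D' i k hD h j hj
    have h1 := abs_le.1 (hq i D D' hD)
    have h2 := abs_le.1 (hq j D D' hD)
    have h3 := h j hj
    push_cast at h3
    linarith
  have hrstep : ∀ D D' i, Adjacent D D' → r D i ≤ r D' i + 1 := by
    intro D D' i hD
    calc r D i ≤ #(insert 0 ({k ∈ range m | U k D' i}.image (· + 1))) := by
          apply Finset.card_le_card
          intro k hk
          rw [mem_filter, mem_range] at hk
          rcases k with _ | k
          · exact mem_insert_self _ _
          · refine mem_insert_of_mem (mem_image_of_mem _ ?_)
            rw [mem_filter, mem_range]
            exact ⟨by omega, hstep D D' i k hD hk.2⟩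
      _ ≤ _ := (card_insert_le _ _).trans (Nat.add_le_add_right card_image_le _)
  have hpos : ∀ D i, r D i ≠ 0 → ∀ j, j ≠ i → q j D + 2 * s < q i D := by
    intro D i h j hj
    obtain ⟨k, hk⟩ := Finset.card_ne_zero.1 h
    have h1 := (mem_filter.1 hk).2 j hj
    have : 0 ≤ 2 * s * k := by positivity
    linarith
  have hzero : ∀ D i, (∀ j, j ≠ i → q j D < q i D) → ∀ j, j ≠ i → r D j = 0 := by
    intro D i h j hj
    by_contra hne
    linarith [hpos D j hne i hj.symm, h j hj]
  set p : Dataset X n → Fin K → ℝ := fun D i => marginProb ε δ (r D i) with hp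
  set lead : Dataset X n → Fin K := fun D => if h : ∃ i, r D i ≠ 0 then h.choose else d with hlead
  -- If all margins vanish, `lead` is the default, but the mixing weight is 0 and any `i` gives the
  -- same masses.
  have hleadeq : ∀ D i, (∀ j, j ≠ i → r D j = 0) → ∀ j,
      mixMass d (p D (lead D)) (lead D) j = mixMass d (p D i) i j := by
    intro D i h j
    by_cases hi : lead D = i
    · rw [hi]
    have hall : ∀ i', r D i' = 0 := by
      by_contra hne
      push Not at hne
      apply hi
      by_contra hli
      have h1 : r D (lead D) ≠ 0 := by
        simp only [hlead, dif_pos hne]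
        exact hne.choose_spec
      exact h1 (h _ hli)
    simp [mixMass, hp, hall, marginProb_zero]
  have hf0 : ∀ D j, 0 ≤ mixMass d (p D (lead D)) (lead D) j := by
    intro D j
    have h1 : 0 ≤ p D (lead D) := marginProb_nonneg hδ.le _
    have h2 : p D (lead D) ≤ 1 := marginProb_le_one hδ.le _
    unfold mixMass
    apply add_nonneg <;> split_ifs <;> linarith
  have hf1 : ∀ D, ∑ j, mixMass d (p D (lead D)) (lead D) j = 1 := by
    intro D
    simp [sum_mixMass]
  have hcommon : ∀ D D', Adjacent D D' → ∃ i, (∀ j, j ≠ i → r D j = 0) ∧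
      ∀ j, j ≠ i → r D' j = 0 := by
    have hone : ∀ D D', Adjacent D D' → ∀ i, r D i ≠ 0 → (∀ j, j ≠ i → r D j = 0) ∧
        ∀ j, j ≠ i → r D' j = 0 := by
      intro D D' hD i hi
      refine ⟨hzero D i fun j hj => ?_, hzero D' i fun j hj => ?_⟩
      · linarith [hpos D i hi j hj]
      · linarith [hpos D i hi j hj, abs_le.1 (hq i D D' hD), abs_le.1 (hq j D D' hD)]
    intro D D' hD
    by_cases h : ∃ i, r D i ≠ 0
    · obtain ⟨i, hi⟩ := h
      exact ⟨i, hone D D' hD i hi⟩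
    by_cases h' : ∃ i, r D' i ≠ 0
    · obtain ⟨i, hi⟩ := h'
      exact ⟨i, (hone D' D hD.symm i hi).symm⟩
    push Not at h h'
    exact ⟨d, fun j _ => h j, fun j _ => h' j⟩
  refine ⟨fun D => pmfOfReal _ (hf0 D) (hf1 D), isDP_pmfOfReal hδ.le _ hf0 hf1 ?_, ?_⟩
  · intro D D' hD S
    obtain ⟨i, hi, hi'⟩ := hcommon D D' hD
    simp only [hleadeq D i hi, hleadeq D' i hi', sum_mixMass]
    have h1 := marginProb_le hε.le hδ.le (hrstep D D' i hD)
    have h2 := one_sub_marginProb_le hε.le hδ.le (hrstep D' D i hD.symm)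
    have he : 1 ≤ Real.exp ε := Real.one_le_exp hε.le
    simp only [hp]
    -- An event has mass `p`, `1 - p`, 1 or 0, according to which of `i`, `d` it contains.
    split_ifs <;> linarith
  · intro D iStar h
    have hrm : r D iStar = m := by
      simp only [hr]
      rw [filter_true_of_mem, card_range]
      intro k hk j hj
      have h1 : (k : ℝ) + 1 ≤ m := by exact_mod_cast mem_range.1 hk
      have := mul_le_mul_of_nonneg_left h1 (by positivity : 0 ≤ 2 * s)
      linarith [h j hj]
    have hz := hzero D iStar fun j hj => by
      have : 0 ≤ 2 * s * m := by positivity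
      linarith [h j hj]
    simp only [Mechanism.prob, pmfOfReal_toMeasure]
    apply ENNReal.ofReal_le_ofReal
    simp only [hleadeq D iStar hz, sum_mixMass]
    have hbound : 1 - p D iStar ≤ β := by
      simp only [hp, hrm]
      rw [one_sub_marginProb hδ.le hm0]
      have h1 : 1 / (β * δ) ≤ Real.exp (ε * (m - 1)) :=
        (Real.log_le_iff_le_exp (by positivity)).1 hm
      rw [div_le_iff₀ (by positivity)] at h1 ⊢
      nlinarith
    have : (if d ∈ univ.filter (· ∈ {i | i ≠ iStar}) then 1 - p D iStar else 0) ≤ β := by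
      split_ifs
      · exact hbound
      · exact hβ.le
    simpa using this

end Basic

end PrivSel

/-! ### The four mechanisms with a common constant. -/

theorem mainTheorem10 :
    ∃ C : ℝ, 0 < C ∧
      ∀ (X : Type*) (n K : ℕ), 0 < K → ∀ q : Fin K → PrivSel.Dataset X n → ℝ,
        -- exponential mechanism
        (∀ s ε β : ℝ, 0 ≤ s → 0 < ε → 0 < β → β < 1 →
          (∀ i, PrivSel.SensitivityAtMost (q i) s) →
          ∃ M : PrivSel.Mechanism X n K, PrivSel.IsDP ε 0 M ∧
            ∀ (D : PrivSel.Dataset X n) (iStar : Fin K), PrivSel.IsMaximizer q D iStar →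
              M.prob D {i | ¬ q iStar D - C * (s * Real.log (K / β) / ε) ≤ q i D}
                ≤ ENNReal.ofReal β) ∧
        -- generalized exponential mechanism
        (∀ (s : Fin K → ℝ) (ε δ β : ℝ), (∀ i, 0 ≤ s i) → 0 < ε → 0 ≤ δ → 0 < β → β < 1 →
          (∀ i, PrivSel.SensitivityAtMost (q i) (s i)) →
          ∃ M : PrivSel.Mechanism X n K, PrivSel.IsDP ε δ M ∧
            ∀ (D : PrivSel.Dataset X n) (iStar : Fin K), PrivSel.IsMaximizer q D iStar →
              M.prob D {i | ¬ q iStar D - C * (s iStar * Real.log (K / β) / ε) ≤ q i D}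
                ≤ ENNReal.ofReal β) ∧
        -- margin-based mechanism
        (∀ s ε δ β : ℝ, 0 < s → 0 < ε → ε < 1 → 0 < δ → δ < 1 / 4 → 0 < β → β < 1 →
          (∀ i, PrivSel.SensitivityAtMost (q i) s) →
          ∃ M : PrivSel.Mechanism X n K, PrivSel.IsDP ε δ M ∧
            ∀ (D : PrivSel.Dataset X n) (iStar : Fin K), PrivSel.IsMaximizer q D iStar →
              (∀ i, i ≠ iStar →
                q i D + C * (s * Real.log (1 / (β * δ)) / ε) ≤ q iStar D) →
              M.prob D {i | i ≠ iStar} ≤ ENNReal.ofReal β) ∧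
        -- generalized smooth sensitivity exponential mechanism
        (∀ (s : Fin K → PrivSel.Dataset X n → ℝ) (ε δ β : ℝ), (∀ i D, 0 ≤ s i D) →
          0 < ε → 0 < δ → 0 < β → β < 1 → δ ≤ β / K →
          (∀ i D, PrivSel.smoothSensitivity (ε / (4 * Real.log (2 / δ))) (q i) D
            ≤ ENNReal.ofReal (s i D)) →
          ∃ M : PrivSel.Mechanism X n K, PrivSel.IsDP ε δ M ∧
            ∀ (D : PrivSel.Dataset X n) (iStar : Fin K), PrivSel.IsMaximizer q D iStar →
              M.prob D {i | ¬ q iStar D - C * (s iStar D * Real.log (K / β) / ε) ≤ q i D}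
                ≤ ENNReal.ofReal β) := by
  refine ⟨10, by norm_num, fun X n K hK q => ?_⟩
  have hK1 : (1 : ℝ) ≤ K := by exact_mod_cast hK
  have gen : ∀ (s : Fin K → ℝ) (ε δ β : ℝ), (∀ i, 0 ≤ s i) → 0 < ε → 0 ≤ δ → 0 < β → β < 1 →
      (∀ i, PrivSel.SensitivityAtMost (q i) (s i)) →
      ∃ M : PrivSel.Mechanism X n K, PrivSel.IsDP ε δ M ∧
        ∀ (D : PrivSel.Dataset X n) (iStar : Fin K), PrivSel.IsMaximizer q D iStar →
          M.prob D {i | ¬ q iStar D - 10 * (s iStar * Real.log (K / β) / ε) ≤ q i D}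
            ≤ ENNReal.ofReal β := by
    intro s ε δ β hs hε hδ hβ hβ1 hq
    obtain ⟨M, hM, hMβ⟩ := PrivSel.exists_mechanism_of_smooth hK q (fun i _ => s i) (η := 0)
      hε hβ hβ1 le_rfl (by norm_num) (fun i _ => hs i) (fun i D D' h => hq i D D' h)
      (fun i D D' _ => by simp)
    exact ⟨M, hM.mono hδ, fun D iStar _ => hMβ D iStar⟩
  refine ⟨?_, gen, ?_, ?_⟩
  · intro s ε β hs hε hβ hβ1 hq
    exact gen (fun _ => s) ε 0 β (fun _ => hs) hε le_rfl hβ hβ1 hq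
  · intro s ε δ β hs hε hε1 hδ hδ4 hβ hβ1 hq
    set Λ := Real.log (1 / (β * δ)) with hΛ
    have hΛ1 : 1 < Λ := by
      rw [hΛ, Real.lt_log_iff_exp_lt (by positivity)]
      refine (Real.exp_one_lt_d9.trans (by norm_num : (2.7182818286 : ℝ) < 4)).trans ?_
      rw [lt_div_iff₀ (by positivity)]
      nlinarith
    have hΛε : 1 < Λ / ε := by rw [lt_div_iff₀ hε]; linarith
    have hle := Nat.le_ceil (Λ / ε)
    have hlt := Nat.ceil_lt_add_one (zero_le_one.trans hΛε.le)
    -- The extra 1 offsets the `m - 1` in the odds. Since `Λ / ε > 1`, the margin `2 * s * m` stays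
    -- below `6 * s * Λ / ε`.
    obtain ⟨M, hM, hMβ⟩ := PrivSel.exists_margin_mechanism hK q hs hε hδ hβ (⌈Λ / ε⌉₊ + 1)
      (by rw [div_le_iff₀ hε] at hle; push_cast; linarith) (Nat.succ_ne_zero _) hq
    refine ⟨M, hM, fun D iStar _ h => hMβ D iStar fun i hi => ?_⟩
    have h1 := h i hi
    rw [mul_div_assoc] at h1
    push_cast
    nlinarith
  · intro s ε δ β hs hε hδ hβ hβ1 hδβ hsm
    have hβK : β / K < 1 := by rw [div_lt_one (by linarith)]; linarith
    have hlog : Real.log (K / β) ≤ Real.log (2 / δ) := by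
      apply Real.log_le_log (by positivity)
      rw [div_le_div_iff₀ hβ hδ]
      rw [le_div_iff₀ (by linarith)] at hδβ
      linarith
    have hlogpos : 0 < Real.log (2 / δ) := Real.log_pos (by rw [lt_div_iff₀ hδ]; linarith)
    set η := ε / (4 * Real.log (2 / δ)) with hη
    have hη0 : 0 ≤ η := by positivity
    have hfin : ∀ i D, PrivSel.smoothSensitivity η (q i) D ≠ ⊤ := fun i D =>
      ne_top_of_le_ne_top ENNReal.ofReal_ne_top (hsm i D)
    -- The given `s` need not vary smoothly, so the smoothed sensitivity itself is used; it is
    -- finite because `s` bounds it.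
    obtain ⟨M, hM, hMβ⟩ := PrivSel.exists_mechanism_of_smooth hK q
      (fun i D => (PrivSel.smoothSensitivity η (q i) D).toReal) (η := η) hε hβ hβ1 hη0
      (by
        have : η * (2 * Real.log (K / β) / ε) = Real.log (K / β) / Real.log (2 / δ) / 2 := by
          rw [hη]; field_simp; norm_num
        rw [this]
        linarith [(div_le_one hlogpos).2 hlog])
      (fun i D => ENNReal.toReal_nonneg)
      (fun i D D' h => by
        refine (ENNReal.ofReal_le_iff_le_toReal (hfin i D)).1 (le_trans ?_
          (PrivSel.localSensitivity_le_smoothSensitivity η (q i) D))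
        exact le_iSup₂ (f := fun D' (_ : PrivSel.Adjacent D D') =>
          ENNReal.ofReal |q i D - q i D'|) D' h)
      (fun i D D' h => by
        have := ENNReal.toReal_mono (ENNReal.mul_ne_top ENNReal.ofReal_ne_top (hfin i D'))
          (PrivSel.smoothSensitivity_le_exp_mul hη0 (q i) h)
        rwa [ENNReal.toReal_mul, ENNReal.toReal_ofReal (Real.exp_pos η).le] at this)
    refine ⟨M, hM.mono hδ.le, fun D iStar _ => le_trans ?_ (hMβ D iStar)⟩
    refine MeasureTheory.measure_mono fun i hi h => hi (le_trans ?_ h)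
    have hL : 0 ≤ Real.log (K / β) := Real.log_nonneg (by rw [le_div_iff₀ hβ]; linarith)
    gcongr
    exact ENNReal.toReal_le_of_le_ofReal (hs iStar D) (hsm iStar D)
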